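/- **Setting.** A labeled graph is a pair $(G,\ell)$ with $G$ a nonempty finite simple graph and $\ell:V(G)\to\{0,1\}^*$; a distributed language is a set of labeled graphs. Fix $N:\mathbb N\to\mathbb N$ with $N(n)\ge n$ and $N(n)=\mathrm{poly}(n)$. In an $n$-node graph the nodes have distinct identifiers in $[1,N(n)]$; initially a node knows $n$, its identifier, the identifiers of its neighbors, and its label. Computation is synchronous and all nodes run the same algorithm. In a LOCAL round a node sends a bit string of any length to each neighbor (possibly different strings to different neighbors); a CONGEST round is the same, with strings of $O(\log n)$ bits; in a BCC round a node sends one and the same string of $O(\log n)$ bits to all other nodes. Local computation is unrestricted. After the last round every node accepts or rejects. A deterministic algorithm decides $\mathcal L$ if for every labeled graph $(G,\ell)$ and every assignment of identifiers: $(G,\ell)\in\mathcal L$ if and only if all nodes accept. A randomized algorithm (with shared or private coins) decides $\mathcal L$ with error probability at most $\delta$ if, for every $(G,\ell)$ and every assignment of identifiers, this equivalence fails with probability at most $\delta$. Let $\mathbf L$ be the class of languages decided deterministically in one LOCAL round, and for $X,Y\in\{\mathbf B,\mathbf C\}$ let $XY$ be the class of languages decided deterministically by a round of type $X$ followed by a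 round of type $Y$, where $\mathbf B$ stands for BCC and $\mathbf C$ for CONGEST. For bit strings, $\mathrm{DISJ}(x,y)=1$ means that there is no position $i$ with $x_i=y_i=1$; $\bot$ is the empty string. Let $\mathcal D$ (disjointness-on-edge) be the language of all $(G,\ell)$ such that, for some $k>2$, $G$ has $2k$ nodes and maximum degree at most 2, every label is in $\{0,1\}^k\cup\{\bot\}$, and $\mathrm{DISJ}(\ell(u),\ell(v))=1$ for every edge $\{u,v\}$. Let $\mathcal D_{\mathrm{path}}\subseteq\mathcal D$ be the language of all $(P,\ell)$ such that, for some $k>2$, $P$ is the path $(u_k,\dots,u_1,v_1,\dots,v_k)$, $\ell(u_1),\ell(v_1)\in\{0,1\}^k$, $\mathrm{DISJ}(\ell(u_1),\ell(v_1))=1$, and $\ell(w)=\bot$ for all $w\notin\{u_1,v_1\}$. **Theorem.** $\mathcal D\in\mathbf L\smallsetminus(\mathbf B\mathbf B\cup\mathbf B\mathbf C\cup\mathbf C\mathbf B\cup\mathbf C\mathbf C)$; in particular this set is nonempty. Moreover, for every $\varepsilon>0$, no randomized algorithm that performs two rounds, each of type BCC or CONGEST (in any of the four combinations), decides $\mathcal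 D$ with error probability at most $\frac12-\varepsilon$. Neither does $\mathcal D_{\mathrm{path}}$ belong to $\mathbf B\mathbf B\cup\mathbf B\mathbf C\cup\mathbf C\mathbf B\cup\mathbf C\mathbf C$, and for every $\varepsilon>0$ no such randomized algorithm decides it with error probability at most $\frac12-\varepsilon$. -/

import Mathlib

open MeasureTheory

namespace HybridModels

/-- Bit strings; used for labels and for messages. -/
abbrev Bits := List Bool

/-- A labeled graph `(G, ℓ)`: a nonempty finite simple graph, on the vertex set `Fin n` without loss of
generality, with a label in `{0,1}^*` on every vertex. The vertex names are never visible to an algorithm. -/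
structure LabeledGraph where
  n : ℕ
  pos : 0 < n
  graph : SimpleGraph (Fin n)
  label : Fin n → Bits

/-- A distributed language is a collection of labeled graphs. -/
abbrev DistLanguage := Set LabeledGraph

/-- The three kinds of communication rounds. -/
inductive Round where
  | LOCAL
  | BCC
  | CONGEST

/-- What a node knows before any communication: the number of nodes, its identifier, the identifiers of its
neighbors, and its label. -/
structure Knowledge where
  size : ℕ
  ident : ℕ
  nbrs : Set ℕ
  label : Bits

/-- What a node receives in one round: the messages, each with the identifier of its sender. -/
abbrev Inbox := Set (ℕ × Bits)

/-- A (deterministic) distributed algorithm, the same at every node. All choices of a node depend on its initial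
knowledge and on the list of the inboxes of the previous rounds (whose length tells the round number).
`unicast K h d` is the message for the neighbor with identifier `d` in a LOCAL or CONGEST round, `broadcast K h` is the
message for all other nodes in a BCC round, and `accept K h` is the final verdict. As usual in these models,
local computation is free. -/
structure Algorithm where
  unicast : Knowledge → List Inbox → ℕ → Bits
  broadcast : Knowledge → List Inbox → Bits
  accept : Knowledge → List Inbox → Bool

/-- In an algorithm with the sequence `s` of rounds, all messages of CONGEST rounds and BCC rounds have at most `b n`
bits in `n`-node networks. Messages of LOCAL rounds are unrestricted. -/
def Algorithm.HasBandwidth (A : Algorithm) (s : List Round) (b : ℕ → ℕ) : Prop :=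
  ∀ (K : Knowledge) (h : List Inbox),
    (s[h.length]? = some Round.CONGEST → ∀ d, (A.unicast K h d).length ≤ b K.size) ∧
    (s[h.length]? = some Round.BCC → (A.broadcast K h).length ≤ b K.size)

/-- `b` is `O(log n)`. -/
def IsLogarithmic (b : ℕ → ℕ) : Prop :=
  (fun n : ℕ => (b n : ℝ)) =O[Filter.atTop] (fun n : ℕ => Real.log n)

/-- Admissible ranges `[1, N n]` of identifiers: large enough for `n` distinct identifiers, and `N n = poly(n)`. -/
def IsIdRange (N : ℕ → ℕ) : Prop :=
  (∀ n, n ≤ N n) ∧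
    ∃ k : ℕ, (fun n : ℕ => (N n : ℝ)) =O[Filter.atTop] (fun n : ℕ => (n : ℝ) ^ k)

/-- `ident` assigns distinct identifiers in `[1, N n]` to the nodes. -/
def IsIdAssignment (N : ℕ → ℕ) (I : LabeledGraph) (ident : Fin I.n → ℕ) : Prop :=
  Function.Injective ident ∧ ∀ v, 1 ≤ ident v ∧ ident v ≤ N I.n

section Execution

variable (A : Algorithm) (I : LabeledGraph) (ident : Fin I.n → ℕ)

/-- The initial knowledge of node `v`. -/
def knowledge (v : Fin I.n) : Knowledge where
  size := I.n
  ident := ident v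
  nbrs := ident '' I.graph.neighborSet v
  label := I.label v

/-- What node `v` receives in a round, if `h` collects what the nodes received in the previous rounds. -/
def received (h : Fin I.n → List Inbox) (v : Fin I.n) : Round → Inbox
  | Round.LOCAL =>
      {p | ∃ u, I.graph.Adj u v ∧ p = (ident u, A.unicast (knowledge I ident u) (h u) (ident v))}
  | Round.CONGEST =>
      {p | ∃ u, I.graph.Adj u v ∧ p = (ident u, A.unicast (knowledge I ident u) (h u) (ident v))}
  | Round.BCC =>
      {p | ∃ u, u ≠ v ∧ p = (ident u, A.broadcast (knowledge I ident u) (h u))}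

/-- Perform the given rounds, starting with the histories `h`. -/
def run : List Round → (Fin I.n → List Inbox) → (Fin I.n → List Inbox)
  | [], h => h
  | r :: s, h => run s (fun v => h v ++ [received A I ident h v r])

/-- All nodes accept after the rounds in `s`. -/
def AllAccept (s : List Round) : Prop :=
  ∀ v, A.accept (knowledge I ident v) (run A I ident s (fun _ => []) v) = true

end Execution

/-- The class of languages decided by a deterministic algorithm that performs the rounds in `s`, with
identifiers in `[1, N n]`. -/
def Decided (N : ℕ → ℕ) (s : List Round) : Set DistLanguage :=
  {𝓛 | ∃ (A : Algorithm) (b : ℕ → ℕ), IsLogarithmic b ∧ A.HasBandwidth s b ∧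
    ∀ (I : LabeledGraph) (ident : Fin I.n → ℕ), IsIdAssignment N I ident →
      (I ∈ 𝓛 ↔ AllAccept A I ident s)}

/-- The class of languages decided with error probability at most `δ` by a randomized algorithm that performs the
rounds in `s`, with identifiers in `[1, N n]`. The random choices are a point `ω` of a probability space that all nodes
can access; private coins are a special case, as a node can use a part of `ω` that is reserved to
its identifier. -/
def RandDecided (N : ℕ → ℕ) (s : List Round) (δ : ℝ) : Set DistLanguage :=
  {𝓛 | ∃ (Ω : Type) (_ : MeasurableSpace Ω) (P : Measure Ω) (_ : IsProbabilityMeasure P)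
      (A : Ω → Algorithm) (b : ℕ → ℕ), IsLogarithmic b ∧ (∀ ω, (A ω).HasBandwidth s b) ∧
    ∀ (I : LabeledGraph) (ident : Fin I.n → ℕ), IsIdAssignment N I ident →
      MeasurableSet {ω | AllAccept (A ω) I ident s} ∧
      P.real {ω | ¬ (I ∈ 𝓛 ↔ AllAccept (A ω) I ident s)} ≤ δ}

/-- Languages decided by one of the four 2-round combinations of CONGEST and BCC. -/
def TwoRound (N : ℕ → ℕ) : Set DistLanguage :=
  Decided N [Round.BCC, Round.BCC] ∪ Decided N [Round.BCC, Round.CONGEST] ∪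
    Decided N [Round.CONGEST, Round.BCC] ∪ Decided N [Round.CONGEST, Round.CONGEST]

/-- The randomized version of `TwoRound`, with error probability at most `δ`. -/
def RandTwoRound (N : ℕ → ℕ) (δ : ℝ) : Set DistLanguage :=
  RandDecided N [Round.BCC, Round.BCC] δ ∪ RandDecided N [Round.BCC, Round.CONGEST] δ ∪
    RandDecided N [Round.CONGEST, Round.BCC] δ ∪ RandDecided N [Round.CONGEST, Round.CONGEST] δ

/-- `DISJ(x, y) = 1`: there is no position at which both strings have a `1`. -/
def Disj (x y : Bits) : Prop :=
  ∀ i : ℕ, ¬ (x[i]? = some true ∧ y[i]? = some true)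

/-- The paths `(u_k, …, u_1, v_1, …, v_k)` with `2k` nodes, `k > 2`, whose two middle nodes `u_1` and `v_1`
are labeled with disjoint `x, y ∈ {0,1}^k`, and whose other nodes are labeled `⊥`, the empty string. -/
def pathDisjointness : DistLanguage :=
  {I | ∃ k : ℕ, 2 < k ∧ ∃ e : SimpleGraph.pathGraph (2 * k) ≃g I.graph,
    (∀ j : Fin (2 * k), ((j : ℕ) + 1 = k ∨ (j : ℕ) = k) → (I.label (e j)).length = k) ∧
    (∀ j : Fin (2 * k), ¬ ((j : ℕ) + 1 = k ∨ (j : ℕ) = k) → I.label (e j) = []) ∧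
    (∀ i j : Fin (2 * k), (i : ℕ) + 1 = k → (j : ℕ) = k → Disj (I.label (e i)) (I.label (e j)))}

/-- The locally checkable version of `pathDisjointness`: graphs with `2k` nodes, `k > 2`, of maximum degree at most 2,
in which every label is in `{0,1}^k` or `⊥` and adjacent nodes have disjoint labels. -/
def disjointnessOnEdge : DistLanguage :=
  {I | ∃ k : ℕ, 2 < k ∧ I.n = 2 * k ∧
    (∀ v, (I.graph.neighborSet v).ncard ≤ 2) ∧
    (∀ v, (I.label v).length = k ∨ I.label v = []) ∧
    (∀ u v, I.graph.Adj u v → Disj (I.label u) (I.label v))}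

end HybridModels

open HybridModels

/-! Membership in `L` is direct: neighbors exchange labels and compare them. For the lower bounds,
put strings `x` and `y` on the two middle nodes of a path with fixed identifiers. Apart from these
two nodes nothing depends on the input, so everything sent in two rounds is determined by what they
send: at most four different messages of `O(log n)` bits per round. Inputs with the same
communication form a combinatorial rectangle (`inboxes_mix`), and the verdict factors over the two
sides, so the accepted pairs form a disjoint union of `T = n^O(1)` rectangles (`exists_rectangles`).

Such a union cannot separate two distributions. Take a random set `s` and a random position `j`,
random bits for `x` inside `s` and for `y` outside, zeros elsewhere, then overwrite position `j` of
both strings by 0 (a disjoint pair) or by 1 (a pair meeting exactly in `j`). On one side of a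
rectangle, the effect of the planted bit is the correlation of a `[0,1]`-valued function on the cube
with coordinate `j`. By a level-one inequality (`level_one`) the sum over `j` of these correlations
is small unless the rectangle is tiny. Summing over rectangles (`rectangles_gap`), the mean
acceptance gap is at most `4l + 8(log T + 1)/(kl)` for every `l > 0`. Error `1/2 - ε` would force a
mean gap of at least `2ε`, which fails for `l = ε/4` and large `k`. Randomness is handled by
averaging the inequality over the coins. -/

namespace HybridModels

/-! ### Fourier analysis on the cube: few rectangles do not detect a planted intersection -/

section Cube

variable {k : ℕ}

/-- The sign `±1` of a bit. -/
def sgn (b : Bool) : ℝ := if b then 1 else -1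

/-- The restriction of `x` to the positions in `s`. -/
def mask (s x : Fin k → Bool) : Fin k → Bool := fun i => x i && s i

/-- The restriction of `x` to the positions in `s`, with position `j` set to `c`. -/
def plant (s : Fin k → Bool) (j : Fin k) (c : Bool) (x : Fin k → Bool) : Fin k → Bool :=
  Function.update (mask s x) j c

theorem sum_cube_exp (t : Fin k → ℝ) :
    ∑ x : Fin k → Bool, Real.exp (∑ j, t j * sgn (x j)) = ∏ j, (2 * Real.cosh (t j)) := by
  have h : ∀ j, 2 * Real.cosh (t j) = ∑ b : Bool, Real.exp (t j * sgn b) := by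
    intro j
    simp [sgn, Real.cosh_eq]
    ring
  simp_rw [h, Real.exp_sum]
  rw [Finset.prod_univ_sum, Fintype.piFinset_univ]

/-- A function on the cube with values in `[0,1]` has small total correlation with the coordinates. -/
theorem level_one (F : (Fin k → Bool) → ℝ) (hF0 : ∀ x, 0 ≤ F x) (hF1 : ∀ x, F x ≤ 1)
    (l L : ℝ) :
    l * ∑ j, |∑ x, F x * sgn (x j)| ≤
      (L + k * l ^ 2 / 2) * ∑ x, F x + Real.exp (-L) * 2 ^ k := by
  let c : Fin k → ℝ := fun j => if 0 ≤ ∑ x, F x * sgn (x j) then 1 else -1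
  have hc : ∀ j, |∑ x, F x * sgn (x j)| = c j * ∑ x, F x * sgn (x j) := by
    intro j
    simp only [c]
    split_ifs with h
    · rw [abs_of_nonneg h, one_mul]
    · rw [abs_of_neg (not_le.1 h), neg_one_mul]
  have hcc : ∀ j, c j ^ 2 = 1 := by
    intro j
    simp only [c]
    split_ifs <;> norm_num
  have h1 : l * ∑ j, |∑ x, F x * sgn (x j)| = ∑ x, F x * ∑ j, (l * c j) * sgn (x j) := by
    simp_rw [hc, Finset.mul_sum]
    rw [Finset.sum_comm]
    refine Finset.sum_congr rfl fun x _ => Finset.sum_congr rfl fun j _ => ?_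
    ring
  -- The shift `k * l ^ 2 / 2` cancels the growth of the exponential moment, `cosh (l * c j) ≤ exp
  -- (l ^ 2 / 2)` per coordinate.
  set E : ℝ := L + k * l ^ 2 / 2 with hE
  -- A Young-type inequality: for `0 ≤ F ≤ 1`, `F * (t - E) ≤ F * exp (t - E) ≤ exp (t - E)`.
  have h2 : ∀ x, F x * ∑ j, (l * c j) * sgn (x j) ≤
      E * F x + Real.exp (-E) * Real.exp (∑ j, (l * c j) * sgn (x j)) := by
    intro x
    set t := ∑ j, (l * c j) * sgn (x j)
    have h3 := Real.add_one_le_exp (t - E)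
    rw [← Real.exp_add]
    have h4 : Real.exp (-E + t) = Real.exp (t - E) := by congr 1; ring
    rw [h4]
    have h5 := Real.exp_pos (t - E)
    nlinarith [hF0 x, hF1 x, mul_le_mul_of_nonneg_left h3 (hF0 x),
      mul_le_mul_of_nonneg_right (hF1 x) h5.le]
  rw [h1]
  refine (Finset.sum_le_sum fun x _ => h2 x).trans ?_
  rw [Finset.sum_add_distrib, ← Finset.mul_sum, ← Finset.mul_sum, sum_cube_exp]
  refine add_le_add_right ?_ _
  have h6 : ∏ j, (2 * Real.cosh (l * c j)) ≤ ∏ _j : Fin k, (2 * Real.exp (l ^ 2 / 2)) := by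
    refine Finset.prod_le_prod (fun j _ => by positivity) fun j _ => ?_
    have := Real.cosh_le_exp_half_sq (l * c j)
    rw [mul_pow, hcc, mul_one] at this
    linarith
  calc Real.exp (-E) * ∏ j, (2 * Real.cosh (l * c j))
      ≤ Real.exp (-E) * ∏ _j : Fin k, (2 * Real.exp (l ^ 2 / 2)) := by gcongr
    _ = Real.exp (-L) * 2 ^ k := by
      rw [Finset.prod_const, Finset.card_univ, Fintype.card_fin, mul_pow, ← Real.exp_nat_mul,
        mul_left_comm, ← Real.exp_add, mul_comm]
      congr 2
      rw [hE]
      ring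

theorem sum_flip (j : Fin k) (h : (Fin k → Bool) → ℝ) :
    ∑ x, h (Function.update x j (!x j)) = ∑ x, h x := by
  refine Fintype.sum_equiv (Function.Involutive.toPerm
    (fun x : Fin k → Bool => Function.update x j (!x j)) ?_) _ _ fun x => rfl
  intro x
  simp

/-- A sum over the cube of a function that ignores coordinate `j` is twice the sum over a facet. -/
theorem sum_eq_two_mul_facet (j : Fin k) (h : (Fin k → Bool) → ℝ)
    (hh : ∀ x c, h (Function.update x j c) = h x) (c : Bool) :
    ∑ x, h x = 2 * ∑ x, if x j = c then h x else 0 := by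
  have h1 := sum_flip j fun x => if x j = c then h x else 0
  simp only [hh, Function.update_self] at h1
  rw [two_mul]
  nth_rewrite 1 [← h1]
  rw [← Finset.sum_add_distrib]
  refine Finset.sum_congr rfl fun x _ => ?_
  cases x j <;> cases c <;> simp

theorem plant_update_left (s x : Fin k → Bool) (j : Fin k) (c d : Bool) :
    plant (Function.update s j d) j c x = plant s j c x := by
  funext i
  by_cases h : i = j
  · subst h; simp [plant]
  · simp [plant, mask, h]

theorem plant_update_right (s x : Fin k → Bool) (j : Fin k) (c d : Bool) :
    plant s j c (Function.update x j d) = plant s j c x := by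
  funext i
  by_cases h : i = j
  · subst h; simp [plant]
  · simp [plant, mask, h]

/-- The unnormalized mass of `f` under the planted distribution. -/
def mass (f : (Fin k → Bool) → ℝ) (s : Fin k → Bool) (j : Fin k) (c : Bool) : ℝ :=
  ∑ x, f (plant s j c x)

theorem mass_nonneg {f : (Fin k → Bool) → ℝ} (hf : ∀ x, 0 ≤ f x) (s j c) :
    0 ≤ mass f s j c :=
  Finset.sum_nonneg fun _ _ => hf _

/-- The complement of a set of positions. -/
def flipAll (s : Fin k → Bool) : Fin k → Bool := fun i => !s i

theorem flipAll_flipAll (s : Fin k → Bool) : flipAll (flipAll s) = s := by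
  funext i; simp [flipAll]

theorem sum_flipAll (h : (Fin k → Bool) → ℝ) : ∑ s, h (flipAll s) = ∑ s, h s :=
  Fintype.sum_equiv (Function.Involutive.toPerm flipAll flipAll_flipAll) _ _ fun _ => rfl

theorem flipAll_update (s : Fin k → Bool) (j : Fin k) (c : Bool) :
    flipAll (Function.update s j c) = Function.update (flipAll s) j (!c) := by
  funext i
  by_cases h : i = j
  · subst h; simp [flipAll]
  · simp [flipAll, h]

/-- Planting overwrites position `j`, so it does not matter whether `j` belongs to `s`. This freedom
is used to put `j` on whichever side is convenient. -/
theorem mass_update (f : (Fin k → Bool) → ℝ) (s j c d) :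
    mass f (Function.update s j d) j c = mass f s j c := by
  simp [mass, plant_update_left]

/-- If `j` lies in `s`, planting the bit amounts to conditioning the masked string on its coordinate
`j`; the factor 2 is the density of a facet. -/
theorem mass_sub_eq (f : (Fin k → Bool) → ℝ) (s : Fin k → Bool) (j : Fin k) (hs : s j = true) :
    mass f s j true - mass f s j false = 2 * ∑ x, f (mask s x) * sgn (x j) := by
  rw [mass, mass, sum_eq_two_mul_facet j (fun x => f (plant s j true x))
    (fun x c => by rw [plant_update_right]) true,
    sum_eq_two_mul_facet j (fun x => f (plant s j false x))
    (fun x c => by rw [plant_update_right]) false, ← mul_sub, ← Finset.sum_sub_distrib]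
  congr 1
  refine Finset.sum_congr rfl fun x _ => ?_
  have h : mask s x = plant s j (x j) x := by
    funext i
    by_cases h : i = j
    · subst h; simp [plant, mask, hs]
    · simp [plant, mask, h]
  rw [h]
  cases hx : x j <;> simp [sgn]

theorem mass_false_eq (f : (Fin k → Bool) → ℝ) (s : Fin k → Bool) (j : Fin k) (hs : s j = false) :
    mass f s j false = ∑ x, f (mask s x) := by
  refine Finset.sum_congr rfl fun x _ => ?_
  congr 1
  funext i
  by_cases h : i = j
  · subst h; simp [plant, mask, hs]
  · simp [plant, mask, h]

/-- With `j` placed in `s`, the factor of `g` no longer depends on `j`, so the sum over `j` meets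
only `f` and `level_one` applies for each fixed `s`. -/
theorem sum_mass_sub_le (f g : (Fin k → Bool) → ℝ) (hf0 : ∀ x, 0 ≤ f x) (hf1 : ∀ x, f x ≤ 1)
    (hg0 : ∀ x, 0 ≤ g x) (hg1 : ∀ x, g x ≤ 1) (l L : ℝ) (hl : 0 < l) :
    l * ∑ j, ∑ s, |mass f s j false - mass f s j true| * mass g (flipAll s) j false ≤
      4 * ∑ s, ((L + k * l ^ 2 / 2) * ∑ x, ∑ y, f (mask s x) *
        g (mask (flipAll s) y) + Real.exp (-L) * 4 ^ k) := by
  have h1 : ∀ j : Fin k,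
      ∑ s, |mass f s j false - mass f s j true| * mass g (flipAll s) j false ≤
      ∑ s, 4 * (|∑ x, f (mask s x) * sgn (x j)| *
        ∑ y, g (mask (flipAll s) y)) := by
    intro j
    -- The summand ignores `s j`, so only `s j = true` is kept. This factor 2 and the one in
    -- `mass_sub_eq` make the 4.
    rw [sum_eq_two_mul_facet j _ (fun s c => by simp only [flipAll_update, mass_update]) true,
      Finset.mul_sum]
    refine Finset.sum_le_sum fun s _ => ?_
    have hnn : 0 ≤ ∑ y, g (mask (flipAll s) y) := Finset.sum_nonneg fun _ _ => hg0 _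
    split_ifs with hs
    · rw [abs_sub_comm, mass_sub_eq f s j hs, mass_false_eq g _ j (by simp [flipAll, hs]),
        abs_mul, abs_two]
      exact le_of_eq (by ring)
    · rw [mul_zero]; positivity
  calc l * ∑ j, ∑ s, |mass f s j false - mass f s j true| * mass g (flipAll s) j false
      ≤ l * ∑ j, ∑ s, 4 * (|∑ x, f (mask s x) * sgn (x j)| *
        ∑ y, g (mask (flipAll s) y)) := by
        exact mul_le_mul_of_nonneg_left (Finset.sum_le_sum fun j _ => h1 j) hl.le
    _ = 4 * ∑ s, (l * ∑ j, |∑ x, f (mask s x) * sgn (x j)|) *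
        ∑ y, g (mask (flipAll s) y) := by
        rw [Finset.sum_comm]
        simp only [Finset.mul_sum, Finset.sum_mul]
        refine Finset.sum_congr rfl fun s _ => ?_
        rw [Finset.sum_comm]
        refine Finset.sum_congr rfl fun y _ => Finset.sum_congr rfl fun j _ => ?_
        ring
    _ ≤ _ := by
        gcongr with s
        have hnn : 0 ≤ ∑ y, g (mask (flipAll s) y) := Finset.sum_nonneg fun _ _ => hg0 _
        have hle : ∑ y, g (mask (flipAll s) y) ≤ 2 ^ k := by
          refine (Finset.sum_le_sum fun y _ => hg1 _).trans ?_
          simp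
        have h2 := level_one (fun x => f (mask s x)) (fun _ => hf0 _)
          (fun _ => hf1 _) l L
        refine (mul_le_mul_of_nonneg_right h2 hnn).trans ?_
        rw [add_mul, mul_assoc, Finset.sum_mul_sum, mul_assoc]
        gcongr
        calc (2 : ℝ) ^ k * ∑ y, g (mask (flipAll s) y) ≤ 2 ^ k * 2 ^ k := by gcongr
          _ = 4 ^ k := by rw [← mul_pow]; norm_num

/-- Unlike in the usual telescoping, both weights carry index 0. This matters because only the
masses with planted bit 0 become independent of `j`. -/
theorem mul_sub_mul_le_abs {a₀ a₁ b₀ b₁ : ℝ} (ha₀ : 0 ≤ a₀) (ha₁ : 0 ≤ a₁) (hb₀ : 0 ≤ b₀)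
    (hb₁ : 0 ≤ b₁) : a₀ * b₀ - a₁ * b₁ ≤ |a₀ - a₁| * b₀ + a₀ * |b₀ - b₁| := by
  rcases le_total a₀ a₁ with h | h
  · have h1 : a₀ * (b₀ - b₁) ≤ a₀ * |b₀ - b₁| := mul_le_mul_of_nonneg_left (le_abs_self _) ha₀
    have h2 : 0 ≤ |a₀ - a₁| * b₀ := by positivity
    nlinarith [mul_le_mul_of_nonneg_right h hb₁]
  · rw [abs_of_nonneg (sub_nonneg.2 h)]
    have h1 : a₁ * (b₀ - b₁) ≤ a₀ * |b₀ - b₁| :=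
      (mul_le_mul_of_nonneg_left (le_abs_self _) ha₁).trans
        (mul_le_mul_of_nonneg_right h (abs_nonneg _))
    nlinarith

/-- A union of few disjoint rectangles cannot distinguish random disjoint pairs from pairs that
intersect in one random position. -/
theorem rectangles_gap {τ : Type*} [Fintype τ] [Nonempty τ] (f g : τ → (Fin k → Bool) → ℝ)
    (hf0 : ∀ t x, 0 ≤ f t x) (hf1 : ∀ t x, f t x ≤ 1)
    (hg0 : ∀ t x, 0 ≤ g t x) (hg1 : ∀ t x, g t x ≤ 1)
    (hfg : ∀ x y, ∑ t, f t x * g t y ≤ 1) (l : ℝ) (hl : 0 < l) :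
    l * ∑ j, ∑ s, ∑ x, ∑ y,
      (∑ t, f t (plant s j false x) * g t (plant (flipAll s) j false y) -
        ∑ t, f t (plant s j true x) * g t (plant (flipAll s) j true y)) ≤
      8 * 8 ^ k * (Real.log (Fintype.card τ) + k * l ^ 2 / 2 + 1) := by
  set L := Real.log (Fintype.card τ) with hL
  have hTpos : (0 : ℝ) < Fintype.card τ := by exact_mod_cast Fintype.card_pos
  -- `L` is the logarithm of the number of rectangles, so that their error terms `exp (-L)` add up
  -- to 1.
  have hexp : (Fintype.card τ : ℝ) * Real.exp (-L) = 1 := by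
    rw [Real.exp_neg, hL, Real.exp_log hTpos, mul_inv_cancel₀ hTpos.ne']
  have hL0 : 0 ≤ L := Real.log_natCast_nonneg _
  have hrw : ∑ j, ∑ s, ∑ x, ∑ y,
      (∑ t, f t (plant s j false x) * g t (plant (flipAll s) j false y) -
        ∑ t, f t (plant s j true x) * g t (plant (flipAll s) j true y)) =
      ∑ t, ∑ j, ∑ s, (mass (f t) s j false * mass (g t) (flipAll s) j false -
        mass (f t) s j true * mass (g t) (flipAll s) j true) := by
    symm
    rw [Finset.sum_comm]
    refine Finset.sum_congr rfl fun j _ => ?_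
    rw [Finset.sum_comm]
    refine Finset.sum_congr rfl fun s _ => ?_
    simp only [mass, Finset.sum_mul_sum, ← Finset.sum_sub_distrib]
    rw [Finset.sum_comm]
    refine Finset.sum_congr rfl fun x _ => ?_
    rw [Finset.sum_comm]
  have hside : ∀ f g : τ → (Fin k → Bool) → ℝ, (∀ t x, 0 ≤ f t x) → (∀ t x, f t x ≤ 1) →
      (∀ t x, 0 ≤ g t x) → (∀ t x, g t x ≤ 1) → (∀ x y, ∑ t, f t x * g t y ≤ 1) →
      l * ∑ t, ∑ j, ∑ s, |mass (f t) s j false - mass (f t) s j true| *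
        mass (g t) (flipAll s) j false ≤ 4 * 8 ^ k * (L + k * l ^ 2 / 2 + 1) := by
    intro f g hf0 hf1 hg0 hg1 hfg
    rw [Finset.mul_sum]
    refine (Finset.sum_le_sum fun t _ => sum_mass_sub_le (f t) (g t) (hf0 t) (hf1 t) (hg0 t)
      (hg1 t) l L hl).trans ?_
    rw [← Finset.mul_sum, Finset.sum_comm, mul_assoc]
    gcongr
    have h1 : ∀ s : Fin k → Bool, ∑ t, ((L + k * l ^ 2 / 2) * ∑ x, ∑ y,
        f t (mask s x) * g t (mask (flipAll s) y) + Real.exp (-L) * 4 ^ k) ≤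
        4 ^ k * (L + k * l ^ 2 / 2 + 1) := by
      intro s
      rw [Finset.sum_add_distrib, ← Finset.mul_sum, Finset.sum_const, Finset.card_univ,
        nsmul_eq_mul, ← mul_assoc, hexp]
      have h2 : ∑ t, ∑ x, ∑ y, f t (mask s x) * g t (mask (flipAll s) y) ≤
          4 ^ k := by
        rw [Finset.sum_comm]
        calc _ ≤ ∑ _x : Fin k → Bool, ∑ _y : Fin k → Bool, (1 : ℝ) := by
              refine Finset.sum_le_sum fun x _ => ?_
              rw [Finset.sum_comm]
              exact Finset.sum_le_sum fun y _ => hfg _ _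
          _ = 4 ^ k := by
              simp
              rw [← mul_pow]; norm_num
      have h3 : 0 ≤ L + k * l ^ 2 / 2 := by positivity
      nlinarith [mul_le_mul_of_nonneg_left h2 h3]
    refine (Finset.sum_le_sum fun s _ => h1 s).trans (le_of_eq ?_)
    simp
    rw [← mul_assoc, ← mul_pow]
    norm_num
  have h1 := hside f g hf0 hf1 hg0 hg1 hfg
  have h2 := hside g f hg0 hg1 hf0 hf1 (fun x y => by simpa [mul_comm] using hfg y x)
  -- Complementing `s` exchanges the roles of the two sides.
  have h3 : ∑ t, ∑ j, ∑ s, |mass (g t) s j false - mass (g t) s j true| *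
        mass (f t) (flipAll s) j false = ∑ t, ∑ j, ∑ s, mass (f t) s j false *
        |mass (g t) (flipAll s) j false - mass (g t) (flipAll s) j true| := by
    refine Finset.sum_congr rfl fun t _ => Finset.sum_congr rfl fun j _ => ?_
    rw [← sum_flipAll]
    refine Finset.sum_congr rfl fun s _ => ?_
    rw [flipAll_flipAll, mul_comm]
  rw [h3] at h2
  rw [hrw]
  have h4 : ∑ t, ∑ j, ∑ s, (mass (f t) s j false * mass (g t) (flipAll s) j false -
        mass (f t) s j true * mass (g t) (flipAll s) j true) ≤
      ∑ t, ∑ j, ∑ s, |mass (f t) s j false - mass (f t) s j true| *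
        mass (g t) (flipAll s) j false + ∑ t, ∑ j, ∑ s, mass (f t) s j false *
        |mass (g t) (flipAll s) j false - mass (g t) (flipAll s) j true| := by
    simp only [← Finset.sum_add_distrib]
    refine Finset.sum_le_sum fun t _ => Finset.sum_le_sum fun j _ => Finset.sum_le_sum fun s _ => ?_
    exact mul_sub_mul_le_abs (mass_nonneg (hf0 t) _ _ _) (mass_nonneg (hf0 t) _ _ _)
      (mass_nonneg (hg0 t) _ _ _) (mass_nonneg (hg0 t) _ _ _)
  have h5 := mul_le_mul_of_nonneg_left h4 hl.le
  rw [mul_add] at h5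
  linarith

end Cube

/-! ### Communication patterns and the rectangle property -/

section Simulation

/-- The message that a node sends in a round of type `r` to the node with identifier `d`. -/
def message (A : Algorithm) (r : Round) (K : Knowledge) (h : List Inbox) (d : ℕ) : Bits :=
  match r with
  | Round.BCC => A.broadcast K h
  | _ => A.unicast K h d

/-- In a round of type `r`, node `u` sends a message to node `v`. -/
def Link {n : ℕ} (r : Round) (G : SimpleGraph (Fin n)) (u v : Fin n) : Prop :=
  match r with
  | Round.BCC => u ≠ v
  | _ => G.Adj u v

theorem mem_received (A : Algorithm) (I : LabeledGraph) (ident : Fin I.n → ℕ)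
    (h : Fin I.n → List Inbox) (v : Fin I.n) (r : Round) (p : ℕ × Bits) :
    p ∈ received A I ident h v r ↔ ∃ u, Link r I.graph u v ∧
      p = (ident u, message A r (knowledge I ident u) (h u) (ident v)) := by
  cases r <;> rfl

variable (A : Algorithm) {n : ℕ} (pos : 0 < n) (G : SimpleGraph (Fin n)) (ident : Fin n → ℕ)

theorem knowledge_congr {ℓ₁ ℓ₂ : Fin n → Bits} {u : Fin n} (h : ℓ₁ u = ℓ₂ u) :
    knowledge ⟨n, pos, G, ℓ₁⟩ ident u = knowledge ⟨n, pos, G, ℓ₂⟩ ident u := by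
  simp [knowledge, h]

theorem received_subset {ℓ₁ ℓ₂ ℓ₃ : Fin n → Bits} (hℓ : ∀ u, ℓ₃ u = ℓ₁ u ∨ ℓ₃ u = ℓ₂ u)
    {r : Round} {h : Fin n → List Inbox} {H : Fin n → Inbox}
    (h1 : (received A ⟨n, pos, G, ℓ₁⟩ ident h · r) = H)
    (h2 : (received A ⟨n, pos, G, ℓ₂⟩ ident h · r) = H) (v : Fin n) :
    received A ⟨n, pos, G, ℓ₃⟩ ident h v r ⊆ H v := by
  intro p hp
  obtain ⟨u, hu, rfl⟩ := (mem_received _ _ _ _ _ _ _).1 hp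
  rcases hℓ u with e | e
  · rw [knowledge_congr pos G ident e, ← h1]
    exact (mem_received _ _ _ _ _ _ _).2 ⟨u, hu, rfl⟩
  · rw [knowledge_congr pos G ident e, ← h2]
    exact (mem_received _ _ _ _ _ _ _).2 ⟨u, hu, rfl⟩

/-- If two labelings lead to the same inboxes, then so does every mixture of them. -/
theorem received_mix (hid : Function.Injective ident) {ℓ₁ ℓ₂ ℓ₃ : Fin n → Bits}
    (hℓ : ∀ u, ℓ₃ u = ℓ₁ u ∨ ℓ₃ u = ℓ₂ u)
    {r : Round} {h : Fin n → List Inbox} {H : Fin n → Inbox}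
    (h1 : (received A ⟨n, pos, G, ℓ₁⟩ ident h · r) = H)
    (h2 : (received A ⟨n, pos, G, ℓ₂⟩ ident h · r) = H) :
    (received A ⟨n, pos, G, ℓ₃⟩ ident h · r) = H := by
  funext v
  refine (received_subset A pos G ident hℓ h1 h2 v).antisymm ?_
  intro p hp
  have hp' : p ∈ received A ⟨n, pos, G, ℓ₁⟩ ident h v r := by rw [← h1] at hp; exact hp
  obtain ⟨u, hu, rfl⟩ := (mem_received _ _ _ _ _ _ _).1 hp'
  have hm : (ident u, message A r (knowledge ⟨n, pos, G, ℓ₃⟩ ident u) (h u) (ident v)) ∈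
      received A ⟨n, pos, G, ℓ₃⟩ ident h v r := (mem_received _ _ _ _ _ _ _).2 ⟨u, hu, rfl⟩
  have hm1 := received_subset A pos G ident hℓ h1 h2 v hm
  have hm2 : (ident u, message A r (knowledge ⟨n, pos, G, ℓ₃⟩ ident u) (h u) (ident v)) ∈
      received A ⟨n, pos, G, ℓ₁⟩ ident h v r := by rw [← h1] at hm1; exact hm1
  -- Inboxes are sets, but identifiers are distinct, so each sender accounts for only one pair in an
  -- inbox; an inclusion with the same senders is then an equality.
  obtain ⟨u', hu', e⟩ := (mem_received _ _ _ _ _ _ _).1 hm2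
  obtain rfl : u = u' := hid (congrArg Prod.fst e)
  rw [← e]
  exact hm

theorem received_congr {ℓ₁ ℓ₂ : Fin n → Bits} {r : Round} {h : Fin n → List Inbox}
    (hm : ∀ u v, Link r G u v →
      message A r (knowledge ⟨n, pos, G, ℓ₁⟩ ident u) (h u) (ident v) =
        message A r (knowledge ⟨n, pos, G, ℓ₂⟩ ident u) (h u) (ident v)) :
    (received A ⟨n, pos, G, ℓ₁⟩ ident h · r) = (received A ⟨n, pos, G, ℓ₂⟩ ident h · r) := by
  funext v
  ext p
  rw [mem_received, mem_received]
  refine exists_congr fun u => and_congr_right fun hu => ?_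
  rw [hm u v hu]

/-- What the nodes receive in the first round. -/
def firstInbox (ℓ : Fin n → Bits) (r₁ : Round) : Fin n → Inbox :=
  (received A ⟨n, pos, G, ℓ⟩ ident (fun _ => []) · r₁)

/-- What the nodes receive in the second round. -/
def secondInbox (ℓ : Fin n → Bits) (r₁ r₂ : Round) : Fin n → Inbox :=
  (received A ⟨n, pos, G, ℓ⟩ ident (fun v => [firstInbox A pos G ident ℓ r₁ v]) · r₂)

/-- What the nodes receive in two rounds. -/
def inboxes (ℓ : Fin n → Bits) (r₁ r₂ : Round) : (Fin n → Inbox) × (Fin n → Inbox) :=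
  (firstInbox A pos G ident ℓ r₁, secondInbox A pos G ident ℓ r₁ r₂)

/-- The cut-and-paste property of protocols: a node acts on its own label and its inboxes only. Once
the first inboxes agree, the second round starts from common histories and mixes the same way. -/
theorem inboxes_mix (hid : Function.Injective ident) {ℓ₁ ℓ₂ ℓ₃ : Fin n → Bits}
    (hℓ : ∀ u, ℓ₃ u = ℓ₁ u ∨ ℓ₃ u = ℓ₂ u) {r₁ r₂ : Round}
    {H : (Fin n → Inbox) × (Fin n → Inbox)}
    (h1 : inboxes A pos G ident ℓ₁ r₁ r₂ = H) (h2 : inboxes A pos G ident ℓ₂ r₁ r₂ = H) :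
    inboxes A pos G ident ℓ₃ r₁ r₂ = H := by
  obtain ⟨H1, H2⟩ := H
  have a1 : firstInbox A pos G ident ℓ₁ r₁ = H1 := congrArg Prod.fst h1
  have b1 : firstInbox A pos G ident ℓ₂ r₁ = H1 := congrArg Prod.fst h2
  have a2 : secondInbox A pos G ident ℓ₁ r₁ r₂ = H2 := congrArg Prod.snd h1
  have b2 : secondInbox A pos G ident ℓ₂ r₁ r₂ = H2 := congrArg Prod.snd h2
  have c1 : firstInbox A pos G ident ℓ₃ r₁ = H1 := received_mix A pos G ident hid hℓ a1 b1
  refine Prod.ext c1 ?_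
  unfold secondInbox at a2 b2
  rw [a1] at a2
  rw [b1] at b2
  change secondInbox A pos G ident ℓ₃ r₁ r₂ = H2
  unfold secondInbox
  rw [c1]
  exact received_mix A pos G ident hid hℓ a2 b2

/-- A bit string of length at most `B` as an element of a finite type. -/
def pad (B : ℕ) (l : Bits) : Fin B → Option Bool := fun i => l[(i : ℕ)]?

theorem pad_inj {B : ℕ} {l l' : Bits} (hl : l.length ≤ B) (hl' : l'.length ≤ B)
    (h : pad B l = pad B l') : l = l' := by
  refine List.ext_getElem? fun i => ?_
  by_cases hi : i < B
  · exact congrFun h ⟨i, hi⟩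
  · rw [List.getElem?_eq_none (by omega), List.getElem?_eq_none (by omega)]

end Simulation

/-! ### Two-round algorithms on paths as unions of rectangles -/

section Path

variable {k : ℕ}

/-- The label of the middle nodes of a path with `2 * k` nodes are `x` and `y`. -/
def pathLabel (x y : Fin k → Bool) (v : Fin (2 * k)) : Bits :=
  if (v : ℕ) + 1 = k then List.ofFn x else if (v : ℕ) = k then List.ofFn y else []

/-- The path with `2 * k` nodes with labels `x` and `y` in the middle. -/
abbrev pathInstance (hk : 2 < k) (x y : Fin k → Bool) : LabeledGraph :=
  ⟨2 * k, by omega, SimpleGraph.pathGraph (2 * k), pathLabel x y⟩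

/-- Consecutive identifiers along the path. -/
def pathIdent (k : ℕ) (v : Fin (2 * k)) : ℕ := v + 1

theorem pathIdent_injective (k : ℕ) : Function.Injective (pathIdent k) := by
  intro u v h
  simp only [pathIdent] at h
  exact Fin.ext (by omega)

/-- The four pairs of a middle node and a neighbor that determine the communication. -/
def port (hk : 2 < k) : Fin 4 → Fin (2 * k) × Fin (2 * k) :=
  ![(⟨k - 1, by omega⟩, ⟨k - 2, by omega⟩), (⟨k - 1, by omega⟩, ⟨k, by omega⟩),
    (⟨k, by omega⟩, ⟨k - 1, by omega⟩), (⟨k, by omega⟩, ⟨k + 1, by omega⟩)]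

variable (A : Algorithm) (hk : 2 < k) (pos : 0 < 2 * k)

/-- For a fixed history, only the middle nodes see the difference between the labelings. Each has
two neighbors; in a BCC round the receiver is irrelevant and any port of the sender will do. -/
theorem message_eq_of_ports {r : Round} (hr : r ≠ Round.LOCAL) {ℓ₁ ℓ₂ : Fin (2 * k) → Bits}
    (hℓ : ∀ u : Fin (2 * k), (u : ℕ) + 1 ≠ k → (u : ℕ) ≠ k → ℓ₁ u = ℓ₂ u)
    {h : Fin (2 * k) → List Inbox}
    (hp : ∀ i, message A r (knowledge ⟨2 * k, pos, SimpleGraph.pathGraph (2 * k), ℓ₁⟩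
        (pathIdent k) (port hk i).1) (h (port hk i).1) (pathIdent k (port hk i).2) =
      message A r (knowledge ⟨2 * k, pos, SimpleGraph.pathGraph (2 * k), ℓ₂⟩
        (pathIdent k) (port hk i).1) (h (port hk i).1) (pathIdent k (port hk i).2))
    (u v : Fin (2 * k)) (huv : Link r (SimpleGraph.pathGraph (2 * k)) u v) :
    message A r (knowledge ⟨2 * k, pos, SimpleGraph.pathGraph (2 * k), ℓ₁⟩
        (pathIdent k) u) (h u) (pathIdent k v) =
      message A r (knowledge ⟨2 * k, pos, SimpleGraph.pathGraph (2 * k), ℓ₂⟩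
        (pathIdent k) u) (h u) (pathIdent k v) := by
  by_cases hu : (u : ℕ) + 1 ≠ k ∧ (u : ℕ) ≠ k
  · rw [knowledge_congr _ _ _ (hℓ u hu.1 hu.2)]
  have hport : ∃ i, u = (port hk i).1 ∧ (v = (port hk i).2 ∨ r = Round.BCC) := by
    have h4 : r = Round.BCC ∨ (u : ℕ) + 1 = v ∨ (v : ℕ) + 1 = u := by
      cases r with
      | LOCAL => exact absurd rfl hr
      | BCC => exact Or.inl rfl
      | CONGEST => exact Or.inr (SimpleGraph.pathGraph_adj.1 huv)
    have hu' : (u : ℕ) + 1 = k ∨ (u : ℕ) = k := by tauto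
    rcases hu' with e | e <;> rcases h4 with hB | e' | e'
    · exact ⟨0, Fin.ext (by simp [port]; omega), Or.inr hB⟩
    · exact ⟨1, Fin.ext (by simp [port]; omega), Or.inl (Fin.ext (by simp [port]; omega))⟩
    · exact ⟨0, Fin.ext (by simp [port]; omega), Or.inl (Fin.ext (by simp [port]; omega))⟩
    · exact ⟨2, Fin.ext (by simp [port]; omega), Or.inr hB⟩
    · exact ⟨3, Fin.ext (by simp [port]; omega), Or.inl (Fin.ext (by simp [port]; omega))⟩
    · exact ⟨2, Fin.ext (by simp [port]; omega), Or.inl (Fin.ext (by simp [port]; omega))⟩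
  obtain ⟨i, rfl, rfl | rfl⟩ := hport
  · exact hp i
  · exact hp i

/-- The messages sent through the ports in one round. -/
def portCode (B : ℕ) (r : Round) (ℓ : Fin (2 * k) → Bits) (h : Fin (2 * k) → List Inbox) :
    Fin 4 → Fin B → Option Bool := fun i =>
  pad B (message A r (knowledge ⟨2 * k, pos, SimpleGraph.pathGraph (2 * k), ℓ⟩
    (pathIdent k) (port hk i).1) (h (port hk i).1) (pathIdent k (port hk i).2))

theorem received_eq_of_portCode {r : Round} (hr : r ≠ Round.LOCAL) {ℓ₁ ℓ₂ : Fin (2 * k) → Bits}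
    (hℓ : ∀ u : Fin (2 * k), (u : ℕ) + 1 ≠ k → (u : ℕ) ≠ k → ℓ₁ u = ℓ₂ u)
    {h : Fin (2 * k) → List Inbox} {B : ℕ}
    (hB : ∀ K u d, K.size = 2 * k → (message A r K (h u) d).length ≤ B)
    (hc : portCode A hk pos B r ℓ₁ h = portCode A hk pos B r ℓ₂ h) :
    (fun v => received A ⟨2 * k, pos, SimpleGraph.pathGraph (2 * k), ℓ₁⟩ (pathIdent k) h v r) =
      (fun v => received A ⟨2 * k, pos, SimpleGraph.pathGraph (2 * k), ℓ₂⟩ (pathIdent k) h v r) :=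
  received_congr _ _ _ _ (message_eq_of_ports A hk pos hr hℓ fun i =>
    pad_inj (hB _ _ _ rfl) (hB _ _ _ rfl) (congrFun hc i))

theorem length_message_le {s : List Round} {b : ℕ → ℕ} (hb : A.HasBandwidth s b)
    {r : Round} (hr : r ≠ Round.LOCAL) {K : Knowledge} {h : List Inbox}
    (hs : s[h.length]? = some r) (d : ℕ) : (message A r K h d).length ≤ b K.size := by
  cases r with
  | LOCAL => exact absurd rfl hr
  | BCC => exact (hb K h).2 hs
  | CONGEST => exact (hb K h).1 hs d

open Classical in
/-- An algorithm with two rounds accepts a union of few disjoint rectangles. -/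
theorem exists_rectangles {r₁ r₂ : Round} (h₁ : r₁ ≠ Round.LOCAL) (h₂ : r₂ ≠ Round.LOCAL)
    {b : ℕ → ℕ} (hb : A.HasBandwidth [r₁, r₂] b) :
    ∃ (τ : Type) (_ : Fintype τ) (_ : Nonempty τ) (f g : τ → (Fin k → Bool) → ℝ),
      (∀ t x, 0 ≤ f t x) ∧ (∀ t x, f t x ≤ 1) ∧ (∀ t x, 0 ≤ g t x) ∧ (∀ t x, g t x ≤ 1) ∧
      Fintype.card τ ≤ 3 ^ (8 * b (2 * k)) ∧
      ∀ x y, ∑ t, f t x * g t y =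
        if AllAccept A (pathInstance hk x y) (pathIdent k) [r₁, r₂] then 1 else 0 := by
  set B := b (2 * k)
  have pos : 0 < 2 * k := by omega
  let G := SimpleGraph.pathGraph (2 * k)
  let H : (Fin k → Bool) × (Fin k → Bool) → (Fin (2 * k) → Inbox) × (Fin (2 * k) → Inbox) :=
    fun z => inboxes A pos G (pathIdent k) (pathLabel z.1 z.2) r₁ r₂
  let C : (Fin k → Bool) × (Fin k → Bool) → (Fin 2 → Fin 4 → Fin B → Option Bool) :=
    fun z => ![portCode A hk pos B r₁ (pathLabel z.1 z.2) (fun _ => []),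
      portCode A hk pos B r₂ (pathLabel z.1 z.2)
        (fun v => [firstInbox A pos G (pathIdent k) (pathLabel z.1 z.2) r₁ v])]
  have hCH : ∀ z z', C z = C z' → H z = H z' := by
    intro z z' hc
    have hℓ : ∀ u : Fin (2 * k), (u : ℕ) + 1 ≠ k → (u : ℕ) ≠ k →
        pathLabel z.1 z.2 u = pathLabel z'.1 z'.2 u := by
      intro u hu hu'
      simp [pathLabel, hu, hu']
    have e1 : firstInbox A pos G (pathIdent k) (pathLabel z.1 z.2) r₁ =
        firstInbox A pos G (pathIdent k) (pathLabel z'.1 z'.2) r₁ :=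
      received_eq_of_portCode A hk pos h₁ hℓ
        (fun K u d hK => (length_message_le A hb h₁ rfl d).trans (congrArg b hK).le) (congrFun hc 0)
    have hc2 := congrFun hc 1
    -- The second codes are comparable only after `e1` has made the two histories equal.
    simp only [C, Matrix.cons_val_one, Matrix.cons_val_fin_one, e1] at hc2
    refine Prod.ext e1 ?_
    change secondInbox A pos G (pathIdent k) (pathLabel z.1 z.2) r₁ r₂ =
      secondInbox A pos G (pathIdent k) (pathLabel z'.1 z'.2) r₁ r₂
    unfold secondInbox
    rw [e1]
    exact received_eq_of_portCode A hk pos h₂ hℓ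
        (fun K u d hK => (length_message_le A hb h₂ rfl d).trans (congrArg b hK).le) hc2
  have hmix : ∀ x y x' y', H (x, y') = H (x', y) → H (x, y) = H (x, y') := by
    intro x y x' y' h
    refine inboxes_mix A pos G (pathIdent k) (pathIdent_injective k)
      (ℓ₁ := pathLabel x y') (ℓ₂ := pathLabel x' y) ?_ rfl h.symm
    intro u
    by_cases hu : (u : ℕ) + 1 = k
    · left; simp [pathLabel, hu]
    · right; simp [pathLabel, hu]
  let acc : (Fin k → Bool) → (Fin k → Bool) → (Fin (2 * k) → Inbox) × (Fin (2 * k) → Inbox) →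
      Fin (2 * k) → Prop := fun x y t v =>
    A.accept (knowledge (pathInstance hk x y) (pathIdent k) v) [t.1 v, t.2 v] = true
  -- Rectangles are indexed by the communication `t` that occurs. Given `t`, the verdict of node `k`
  -- depends only on `y`, and all other verdicts depend on at most `x`.
  let f : Set.range H → (Fin k → Bool) → ℝ := fun t x =>
    if ∃ y, H (x, y) = t ∧ ∀ v : Fin (2 * k), (v : ℕ) ≠ k → acc x y t v then 1 else 0
  let g : Set.range H → (Fin k → Bool) → ℝ := fun t y =>
    if ∃ x, H (x, y) = t ∧ ∀ v : Fin (2 * k), (v : ℕ) = k → acc x y t v then 1 else 0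
  refine ⟨Set.range H, inferInstance, ⟨⟨_, (fun _ => false, fun _ => false), rfl⟩⟩, f, g,
    fun t x => ?_, fun t x => ?_, fun t x => ?_, fun t x => ?_, ?_, fun x y => ?_⟩
  · simp only [f]; split_ifs <;> norm_num
  · simp only [f]; split_ifs <;> norm_num
  · simp only [g]; split_ifs <;> norm_num
  · simp only [g]; split_ifs <;> norm_num
  · have hinj : Function.Injective fun t : Set.range H => C t.2.choose := by
      intro t t' h
      have := hCH _ _ h
      rw [t.2.choose_spec, t'.2.choose_spec] at this
      exact Subtype.ext this
    -- Two rounds, four ports and `B` ternary symbols per message give `3 ^ (8 * B)`.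
    refine (Fintype.card_le_of_injective _ hinj).trans (le_of_eq ?_)
    simp [← pow_mul]
    ring_nf
  · have hx : ∀ y', ∀ t, ∀ v : Fin (2 * k), (v : ℕ) ≠ k → (acc x y' t v ↔ acc x y t v) := by
      intro y' t v hv
      have : knowledge (pathInstance hk x y') (pathIdent k) v =
          knowledge (pathInstance hk x y) (pathIdent k) v :=
        knowledge_congr _ _ _ (by simp [pathLabel, hv])
      simp only [acc, this]
    have hy : ∀ x', ∀ t, ∀ v : Fin (2 * k), (v : ℕ) = k → (acc x' y t v ↔ acc x y t v) := by
      intro x' t v hv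
      have : knowledge (pathInstance hk x' y) (pathIdent k) v =
          knowledge (pathInstance hk x y) (pathIdent k) v :=
        knowledge_congr _ _ _ (by simp [pathLabel, hv])
      simp only [acc, this]
    rw [Finset.sum_eq_single ⟨H (x, y), (x, y), rfl⟩]
    · have hf : f ⟨H (x, y), (x, y), rfl⟩ x =
          if ∀ v : Fin (2 * k), (v : ℕ) ≠ k → acc x y (H (x, y)) v then 1 else 0 := by
        refine if_congr ⟨?_, fun h => ⟨y, rfl, h⟩⟩ rfl rfl
        rintro ⟨y', -, h⟩ v hv
        exact (hx y' _ v hv).1 (h v hv)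
      have hg : g ⟨H (x, y), (x, y), rfl⟩ y =
          if ∀ v : Fin (2 * k), (v : ℕ) = k → acc x y (H (x, y)) v then 1 else 0 := by
        refine if_congr ⟨?_, fun h => ⟨x, rfl, h⟩⟩ rfl rfl
        rintro ⟨x', -, h⟩ v hv
        exact (hy x' _ v hv).1 (h v hv)
      rw [hf, hg, mul_ite, mul_one, mul_zero, ← ite_and]
      refine if_congr ?_ rfl rfl
      constructor
      · rintro ⟨hb, ha⟩ v
        rcases eq_or_ne (v : ℕ) k with e | e
        · exact hb v e
        · exact ha v e
      · intro h
        exact ⟨fun v _ => h v, fun v _ => h v⟩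
    · rintro t - ht
      by_contra hne
      have hf : f t x ≠ 0 := left_ne_zero_of_mul hne
      have hg : g t y ≠ 0 := right_ne_zero_of_mul hne
      simp only [f, ne_eq, ite_eq_right_iff, not_forall] at hf
      simp only [g, ne_eq, ite_eq_right_iff, not_forall] at hg
      obtain ⟨⟨y', hy', -⟩, -⟩ := hf
      obtain ⟨⟨x', hx', -⟩, -⟩ := hg
      -- If both factors are nonzero, then `t` occurs at `(x, y')` and at `(x', y)`, hence at `(x,
      -- y)`.
      exact ht (Subtype.ext (by rw [← hy']; exact (hmix x y x' y' (hy'.trans hx'.symm)).symm))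
    · intro h
      exact absurd (Finset.mem_univ _) h

end Path

/-! ### The lower bound for every language that encodes disjointness -/

theorem plant_disjoint {k : ℕ} (s x y : Fin k → Bool) (j i : Fin k) :
    ¬ (plant s j false x i = true ∧ plant (flipAll s) j false y i = true) := by
  by_cases h : i = j
  · subst h; simp [plant]
  · cases hs : s i <;> simp [plant, mask, flipAll, h, hs]

theorem plant_self {k : ℕ} (s x : Fin k → Bool) (j : Fin k) (c : Bool) : plant s j c x j = c := by
  simp [plant]

theorem pathIdent_isIdAssignment {N : ℕ → ℕ} (hN : IsIdRange N) {k : ℕ} (hk : 2 < k)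
    (x y : Fin k → Bool) : IsIdAssignment N (pathInstance hk x y) (pathIdent k) := by
  refine ⟨pathIdent_injective k, fun v => ⟨Nat.succ_pos _, ?_⟩⟩
  have h1 := hN.1 (2 * k)
  have h2 : (v : ℕ) < 2 * k := v.2
  change (v : ℕ) + 1 ≤ N (2 * k)
  omega

/-- A language that contains a path instance if and only if its two strings are disjoint. -/
def ContainsDisjointness (𝓛 : DistLanguage) : Prop :=
  ∀ (k : ℕ) (hk : 2 < k) (x y : Fin k → Bool),
    pathInstance hk x y ∈ 𝓛 ↔ ∀ i, ¬ (x i = true ∧ y i = true)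

theorem IsLogarithmic.exists_small {b : ℕ → ℕ} (hb : IsLogarithmic b) {c : ℝ} (hc : 0 < c)
    (m : ℝ) : ∃ k : ℕ, 2 < k ∧ m ≤ c * k ∧ (b (2 * k) : ℝ) ≤ c * k := by
  have h1 : (fun n : ℕ => (b n : ℝ)) =o[Filter.atTop] (fun n : ℕ => (n : ℝ)) :=
    Asymptotics.IsBigO.trans_isLittleO hb
      (Real.isLittleO_log_id_atTop.comp_tendsto tendsto_natCast_atTop_atTop)
  have h2 := h1.bound (half_pos hc)
  have h3 : Filter.Tendsto (fun k : ℕ => 2 * k) Filter.atTop Filter.atTop :=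
    Filter.tendsto_id.const_mul_atTop' (by norm_num)
  have h4 := h3.eventually h2
  have h5 : Filter.Tendsto (fun k : ℕ => c * (k : ℝ)) Filter.atTop Filter.atTop :=
    tendsto_natCast_atTop_atTop.const_mul_atTop hc
  obtain ⟨k, ⟨hk1, hk2⟩, hk3⟩ :=
    ((h4.and (h5.eventually_ge_atTop m)).and (Filter.eventually_gt_atTop 2)).exists
  refine ⟨k, hk3, hk2, ?_⟩
  rw [Real.norm_natCast, Real.norm_natCast] at hk1
  push_cast at hk1
  linarith

open Classical in
theorem path_gap (A : Algorithm) {r₁ r₂ : Round} (h₁ : r₁ ≠ Round.LOCAL) (h₂ : r₂ ≠ Round.LOCAL)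
    {b : ℕ → ℕ} (hb : A.HasBandwidth [r₁, r₂] b) {k : ℕ} (hk : 2 < k) {l : ℝ} (hl : 0 < l) :
    l * ∑ j, ∑ s, ∑ x, ∑ y,
      ((if AllAccept A (pathInstance hk (plant s j false x) (plant (flipAll s) j false y))
          (pathIdent k) [r₁, r₂] then (1 : ℝ) else 0) -
        (if AllAccept A (pathInstance hk (plant s j true x) (plant (flipAll s) j true y))
          (pathIdent k) [r₁, r₂] then (1 : ℝ) else 0)) ≤
      8 * 8 ^ k * (16 * b (2 * k) + k * l ^ 2 / 2 + 1) := by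
  obtain ⟨τ, _, _, f, g, hf0, hf1, hg0, hg1, hcard, hfg⟩ := exists_rectangles A hk h₁ h₂ hb
  have h := rectangles_gap f g hf0 hf1 hg0 hg1
    (fun x y => by rw [hfg]; split_ifs <;> norm_num) l hl
  simp only [hfg] at h
  refine h.trans ?_
  have hlog : Real.log (Fintype.card τ) ≤ 16 * b (2 * k) := by
    have h3 : Real.log 3 ≤ 2 := by
      have := Real.log_le_sub_one_of_pos (show (0 : ℝ) < 3 by norm_num)
      linarith
    calc Real.log (Fintype.card τ) ≤ Real.log ((3 : ℝ) ^ (8 * b (2 * k))) := by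
          refine Real.log_le_log (by exact_mod_cast Fintype.card_pos) ?_
          exact_mod_cast hcard
      _ = 8 * b (2 * k) * Real.log 3 := by rw [Real.log_pow]; push_cast; ring
      _ ≤ 8 * b (2 * k) * 2 := by gcongr
      _ = 16 * b (2 * k) := by ring
  gcongr

/-- The easy direction of Yao's principle: `path_gap` holds for every outcome of the coins, hence
for acceptance probabilities, whose difference is at least `2 * ε` on each planted pair. -/
theorem not_mem_randDecided {N : ℕ → ℕ} (hN : IsIdRange N) {𝓛 : DistLanguage}
    (h𝓛 : ContainsDisjointness 𝓛) {r₁ r₂ : Round} (h₁ : r₁ ≠ Round.LOCAL) (h₂ : r₂ ≠ Round.LOCAL)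
    {ε : ℝ} (hε : 0 < ε) : 𝓛 ∉ RandDecided N [r₁, r₂] (1 / 2 - ε) := by
  classical
  rintro ⟨Ω, _, P, _, A, b, hlog, hb, hdec⟩
  -- After division by `8 ^ k`, with `l = ε / 4`, the lower bound is `k * ε ^ 2 / 2`, against `128 *
  -- b + k * ε ^ 2 / 4 + 8`. The constant 1024 makes the first and last terms at most `k * ε ^ 2 /
  -- 8` and `k * ε ^ 2 / 128`.
  obtain ⟨k, hk, hk1, hk2⟩ := hlog.exists_small (c := ε ^ 2 / 1024) (by positivity) 1
  let S : (Fin k → Bool) → (Fin k → Bool) → Set Ω := fun x y =>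
    {ω | AllAccept (A ω) (pathInstance hk x y) (pathIdent k) [r₁, r₂]}
  have hS : ∀ x y, MeasurableSet (S x y) := fun x y =>
    (hdec _ _ (pathIdent_isIdAssignment hN hk x y)).1
  have hdisj : ∀ x y, (∀ i, ¬ (x i = true ∧ y i = true)) → 1 / 2 + ε ≤ P.real (S x y) := by
    intro x y hxy
    have h1 := (hdec _ _ (pathIdent_isIdAssignment hN hk x y)).2
    simp only [(h𝓛 k hk x y).2 hxy, true_iff] at h1
    have h2 : P.real (S x y)ᶜ ≤ 1 / 2 - ε := h1
    rw [probReal_compl_eq_one_sub (hS x y)] at h2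
    linarith
  have hint : ∀ x y, (∃ i, x i = true ∧ y i = true) → P.real (S x y) ≤ 1 / 2 - ε := by
    intro x y hxy
    have h1 := (hdec _ _ (pathIdent_isIdAssignment hN hk x y)).2
    have h2 : pathInstance hk x y ∉ 𝓛 := by
      rw [h𝓛 k hk x y]
      push Not
      exact hxy
    simp only [h2, false_iff, not_not] at h1
    exact h1
  let φ : (Fin k → Bool) → (Fin k → Bool) → Ω → ℝ := fun x y ω =>
    if AllAccept (A ω) (pathInstance hk x y) (pathIdent k) [r₁, r₂] then 1 else 0
  have hφ : ∀ x y, φ x y = (S x y).indicator 1 := by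
    intro x y
    funext ω
    simp [Set.indicator_apply, S, φ]
  have hI : ∀ x y, Integrable (φ x y) P := by
    intro x y
    rw [hφ]
    exact (integrable_const (1 : ℝ)).indicator (hS x y)
  have hV : ∀ x y, ∫ ω, φ x y ω ∂P = P.real (S x y) := by
    intro x y
    rw [hφ]
    exact integral_indicator_one (hS x y)
  have hi : ∀ (j : Fin k) (s x y : Fin k → Bool), Integrable (fun ω =>
      φ (plant s j false x) (plant (flipAll s) j false y) ω -
        φ (plant s j true x) (plant (flipAll s) j true y) ω) P :=
    fun j s x y => (hI _ _).sub (hI _ _)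
  have hl : 0 < ε / 4 := by positivity
  have hgap := integral_mono (μ := P) (g := fun _ => 8 * 8 ^ k * (16 * (b (2 * k) : ℝ) +
    k * (ε / 4) ^ 2 / 2 + 1)) ?_ (integrable_const _)
    fun ω => path_gap (A ω) h₁ h₂ (hb ω) hk hl
  swap
  · refine Integrable.const_mul ?_ _
    exact integrable_finsetSum _ fun j _ => integrable_finsetSum _ fun s _ =>
      integrable_finsetSum _ fun x _ => integrable_finsetSum _ fun y _ => hi j s x y
  rw [integral_const_mul, integral_const, probReal_univ, one_smul] at hgap
  have hsum : (k : ℝ) * 8 ^ k * (2 * ε) ≤ ∫ ω, ∑ j, ∑ s, ∑ x, ∑ y,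
      (φ (plant s j false x) (plant (flipAll s) j false y) ω -
        φ (plant s j true x) (plant (flipAll s) j true y) ω) ∂P := by
    rw [integral_finsetSum _ fun j _ => integrable_finsetSum _ fun s _ =>
      integrable_finsetSum _ fun x _ => integrable_finsetSum _ fun y _ => hi j s x y]
    have hc : (k : ℝ) * 8 ^ k * (2 * ε) = ∑ _j : Fin k, ∑ _s : Fin k → Bool,
        ∑ _x : Fin k → Bool, ∑ _y : Fin k → Bool, 2 * ε := by
      simp
      rw [show (8 : ℝ) = 2 * (2 * 2) by norm_num, mul_pow, mul_pow]
      ring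
    rw [hc]
    refine Finset.sum_le_sum fun j _ => ?_
    rw [integral_finsetSum _ fun s _ =>
      integrable_finsetSum _ fun x _ => integrable_finsetSum _ fun y _ => hi j s x y]
    refine Finset.sum_le_sum fun s _ => ?_
    rw [integral_finsetSum _ fun x _ => integrable_finsetSum _ fun y _ => hi j s x y]
    refine Finset.sum_le_sum fun x _ => ?_
    rw [integral_finsetSum _ fun y _ => hi j s x y]
    refine Finset.sum_le_sum fun y _ => ?_
    rw [integral_sub (hI _ _) (hI _ _), hV, hV]
    have h3 := hdisj _ _ (plant_disjoint s x y j)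
    have h4 := hint (plant s j true x) (plant (flipAll s) j true y)
      ⟨j, plant_self _ _ _ _, plant_self _ _ _ _⟩
    linarith
  have h5 := (mul_le_mul_of_nonneg_left hsum hl.le).trans hgap
  have h6 : (8 : ℝ) ^ k * (ε / 4 * (k * (2 * ε))) ≤
      8 ^ k * (8 * (16 * (b (2 * k) : ℝ) + k * (ε / 4) ^ 2 / 2 + 1)) := by
    linarith
  have h7 := le_of_mul_le_mul_left h6 (by positivity)
  have hk0 : (0 : ℝ) < k := by exact_mod_cast (show 0 < k by omega)
  have h8 : 0 < ε ^ 2 * k := by positivity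
  nlinarith

theorem decided_subset_randDecided (N : ℕ → ℕ) (s : List Round) :
    Decided N s ⊆ RandDecided N s (1 / 2 - 1 / 4) := by
  rintro 𝓛 ⟨A, b, hlog, hb, hdec⟩
  refine ⟨Unit, ⊤, Measure.dirac (), inferInstance, fun _ => A, b, hlog, fun _ => hb,
    fun I ident h => ⟨trivial, ?_⟩⟩
  simp only [hdec I ident h, not_true_eq_false, Set.ofPred_false, measureReal_empty]
  norm_num

theorem ContainsDisjointness.not_mem_randTwoRound {N : ℕ → ℕ} (hN : IsIdRange N)
    {𝓛 : DistLanguage} (h𝓛 : ContainsDisjointness 𝓛) {ε : ℝ} (hε : 0 < ε) :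
    𝓛 ∉ RandTwoRound N (1 / 2 - ε) := by
  rintro (((h | h) | h) | h) <;>
    exact not_mem_randDecided hN h𝓛 (by simp) (by simp) hε h

theorem ContainsDisjointness.not_mem_twoRound {N : ℕ → ℕ} (hN : IsIdRange N)
    {𝓛 : DistLanguage} (h𝓛 : ContainsDisjointness 𝓛) : 𝓛 ∉ TwoRound N := by
  rintro (((h | h) | h) | h) <;>
    exact not_mem_randDecided hN h𝓛 (by simp) (by simp) (by norm_num)
      (decided_subset_randDecided N _ h)

/-! ### Both languages encode disjointness -/

theorem disj_ofFn {k : ℕ} (x y : Fin k → Bool) :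
    Disj (List.ofFn x) (List.ofFn y) ↔ ∀ i, ¬ (x i = true ∧ y i = true) := by
  constructor
  · intro h i hi
    exact h i (by simpa using hi)
  · intro h i hi
    rw [List.getElem?_eq_some_iff, List.getElem?_eq_some_iff] at hi
    obtain ⟨⟨hi1, e1⟩, ⟨hi2, e2⟩⟩ := hi
    rw [List.length_ofFn] at hi1
    rw [List.getElem_ofFn] at e1 e2
    exact h ⟨i, hi1⟩ ⟨e1, e2⟩

theorem Disj.symm {x y : Bits} (h : Disj x y) : Disj y x := fun i hi => h i hi.symm

theorem disj_nil_left (x : Bits) : Disj [] x := fun i hi => by simp at hi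

theorem disj_nil_right (x : Bits) : Disj x [] := (disj_nil_left x).symm

theorem pathLabel_left {k : ℕ} (x y : Fin k → Bool) {v : Fin (2 * k)} (h : (v : ℕ) + 1 = k) :
    pathLabel x y v = List.ofFn x := if_pos h

theorem pathLabel_right {k : ℕ} (x y : Fin k → Bool) {v : Fin (2 * k)} (h : (v : ℕ) = k) :
    pathLabel x y v = List.ofFn y := by
  rw [pathLabel, if_neg (by omega), if_pos h]

theorem pathLabel_eq_nil {k : ℕ} (x y : Fin k → Bool) {v : Fin (2 * k)} (h : (v : ℕ) + 1 ≠ k)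
    (h' : (v : ℕ) ≠ k) : pathLabel x y v = [] := by
  rw [pathLabel, if_neg h, if_neg h']

theorem containsDisjointness_pathDisjointness : ContainsDisjointness pathDisjointness := by
  intro k hk x y
  rw [← disj_ofFn]
  constructor
  · rintro ⟨k', hk', e, hlen, -, hdisj⟩
    have hkk : k' = k := by
      have := Fintype.card_congr e.toEquiv
      simp only [Fintype.card_fin] at this
      have h2 : 2 * k' = 2 * k := this
      omega
    subst hkk
    -- The isomorphism may reverse the path. Only the middle nodes have nonempty labels, so it
    -- preserves the middle pair, and `Disj` is symmetric.
    have hmid : ∀ j : Fin (2 * k'), ((j : ℕ) + 1 = k' ∨ (j : ℕ) = k') →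
        ((e j : Fin (2 * k')) : ℕ) + 1 = k' ∨ ((e j : Fin (2 * k')) : ℕ) = k' := by
      intro j hj
      by_contra hcon
      push Not at hcon
      have h1 := hlen j hj
      have h2 : (pathInstance hk x y).label (e j) = [] := pathLabel_eq_nil x y hcon.1 hcon.2
      rw [h2, List.length_nil] at h1
      omega
    let i : Fin (2 * k') := ⟨k' - 1, by omega⟩
    let j : Fin (2 * k') := ⟨k', by omega⟩
    have hi : (i : ℕ) + 1 = k' := Nat.sub_add_cancel (by omega)
    have hj : (j : ℕ) = k' := rfl
    have hd := hdisj i j hi hj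
    have hne : (e i : Fin (2 * k')) ≠ e j := fun h => by
      have := congrArg Fin.val (e.injective h)
      omega
    have hne' : ((e i : Fin (2 * k')) : ℕ) ≠ (e j : Fin (2 * k')) := fun h => hne (Fin.ext h)
    change Disj (pathLabel x y (e i)) (pathLabel x y (e j)) at hd
    rcases hmid i (Or.inl hi) with h1 | h1 <;> rcases hmid j (Or.inr hj) with h2 | h2
    · omega
    · rwa [pathLabel_left x y h1, pathLabel_right x y h2] at hd
    · rw [pathLabel_right x y h1, pathLabel_left x y h2] at hd
      exact hd.symm
    · omega
  · intro h
    refine ⟨k, hk, SimpleGraph.Iso.refl, ?_, ?_, ?_⟩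
    · rintro j (hj | hj)
      · change (pathLabel x y j).length = k
        rw [pathLabel_left x y hj, List.length_ofFn]
      · change (pathLabel x y j).length = k
        rw [pathLabel_right x y hj, List.length_ofFn]
    · intro j hj
      push Not at hj
      exact pathLabel_eq_nil x y hj.1 hj.2
    · intro i j hi hj
      change Disj (pathLabel x y i) (pathLabel x y j)
      rwa [pathLabel_left x y hi, pathLabel_right x y hj]

theorem ncard_neighborSet_pathGraph_le (n : ℕ) (v : Fin n) :
    ((SimpleGraph.pathGraph n).neighborSet v).ncard ≤ 2 := by
  have h1 : ((SimpleGraph.pathGraph n).neighborSet v).ncard =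
      (Fin.val '' (SimpleGraph.pathGraph n).neighborSet v).ncard :=
    (Set.ncard_image_of_injective _ Fin.val_injective).symm
  rw [h1]
  have h2 : Fin.val '' (SimpleGraph.pathGraph n).neighborSet v ⊆ {(v : ℕ) + 1, (v : ℕ) - 1} := by
    rintro _ ⟨u, hu, rfl⟩
    have := SimpleGraph.pathGraph_adj.1 hu
    simp only [Set.mem_insert_iff, Set.mem_singleton_iff]
    omega
  exact (Set.ncard_le_ncard h2 (by simp)).trans
    ((Set.ncard_insert_le _ _).trans (by rw [Set.ncard_singleton]))

theorem containsDisjointness_disjointnessOnEdge : ContainsDisjointness disjointnessOnEdge := by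
  intro k hk x y
  rw [← disj_ofFn]
  constructor
  · rintro ⟨k', hk', hn, -, -, hdisj⟩
    let i : Fin (2 * k) := ⟨k - 1, by omega⟩
    let j : Fin (2 * k) := ⟨k, by omega⟩
    have hi : (i : ℕ) + 1 = k := Nat.sub_add_cancel (by omega)
    have hj : (j : ℕ) = k := rfl
    have h := hdisj i j (SimpleGraph.pathGraph_adj.2 (Or.inl (hi.trans hj.symm)))
    change Disj (pathLabel x y i) (pathLabel x y j) at h
    rwa [pathLabel_left x y hi, pathLabel_right x y hj] at h
  · intro h
    refine ⟨k, hk, rfl, ncard_neighborSet_pathGraph_le _, fun v => ?_, fun u v huv => ?_⟩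
    · change (pathLabel x y v).length = k ∨ pathLabel x y v = []
      unfold pathLabel
      split_ifs <;> simp
    · change Disj (pathLabel x y u) (pathLabel x y v)
      have huv' : (u : ℕ) + 1 = v ∨ (v : ℕ) + 1 = u := SimpleGraph.pathGraph_adj.1 huv
      by_cases hu : (u : ℕ) + 1 = k
      · by_cases hv : (v : ℕ) = k
        · rwa [pathLabel_left x y hu, pathLabel_right x y hv]
        · rw [pathLabel_eq_nil x y (v := v) (by omega) hv]
          exact disj_nil_right _
      · by_cases hu' : (u : ℕ) = k
        · by_cases hv : (v : ℕ) + 1 = k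
          · rw [pathLabel_right x y hu', pathLabel_left x y hv]
            exact h.symm
          · rw [pathLabel_eq_nil x y (v := v) hv (by omega)]
            exact disj_nil_right _
        · rw [pathLabel_eq_nil x y (v := u) hu hu']
          exact disj_nil_left _

/-! ### One LOCAL round suffices -/

open Classical in
/-- Every node sends its label to its neighbors and checks the labels that it receives. -/
noncomputable def localChecker : Algorithm where
  unicast K _ _ := K.label
  broadcast _ _ := []
  accept K h := decide (∃ k, 2 < k ∧ K.size = 2 * k ∧ K.nbrs.ncard ≤ 2 ∧
    (K.label.length = k ∨ K.label = []) ∧ ∀ M ∈ h, ∀ p ∈ M, Disj p.2 K.label)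

theorem disjointnessOnEdge_mem_decided_local (N : ℕ → ℕ) :
    disjointnessOnEdge ∈ Decided N [Round.LOCAL] := by
  -- Bandwidth 0 is harmless, since it does not restrict LOCAL rounds.
  refine ⟨localChecker, fun _ => 0, ?_, ?_, ?_⟩
  · simpa [IsLogarithmic] using Asymptotics.isBigO_zero _ _
  · intro K h
    constructor <;> intro hs <;> simp [List.getElem?_cons] at hs
  · intro I ident hid
    have hncard : ∀ v, (ident '' I.graph.neighborSet v).ncard = (I.graph.neighborSet v).ncard :=
      fun v => Set.ncard_image_of_injective _ hid.1
    have hacc : AllAccept localChecker I ident [Round.LOCAL] ↔ ∀ v, ∃ k, 2 < k ∧ I.n = 2 * k ∧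
        (I.graph.neighborSet v).ncard ≤ 2 ∧ ((I.label v).length = k ∨ I.label v = []) ∧
        ∀ u, I.graph.Adj u v → Disj (I.label u) (I.label v) := by
      refine forall_congr' fun v => ?_
      simp only [localChecker, knowledge, run, received, List.nil_append, decide_eq_true_eq,
        hncard, List.mem_singleton, forall_eq, Set.mem_ofPred_eq]
      refine exists_congr fun k => ?_
      refine and_congr_right fun _ => and_congr_right fun _ => and_congr_right fun _ =>
        and_congr_right fun _ => ⟨fun h u hu => h _ ⟨u, hu, rfl⟩, ?_⟩
      rintro h _ ⟨u, hu, rfl⟩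
      exact h u hu
    rw [hacc]
    constructor
    · rintro ⟨k, hk, hn, hdeg, hlab, hdisj⟩ v
      exact ⟨k, hk, hn, hdeg v, hlab v, fun u hu => hdisj u v hu⟩
    · intro h
      obtain ⟨k, hk, hn, -⟩ := h ⟨0, I.pos⟩
      refine ⟨k, hk, hn, fun v => ?_, fun v => ?_, fun u v huv => ?_⟩
      · obtain ⟨_, _, _, hd, _⟩ := h v
        exact hd
      · obtain ⟨k', _, hn', _, hl, _⟩ := h v
        -- Every node knows the size `2 * k`, so the locally chosen `k` is the same everywhere.
        obtain rfl : k' = k := by omega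
        exact hl
      · obtain ⟨_, _, _, _, _, hd⟩ := h v
        exact hd u huv

end HybridModels

theorem mainTheorem7 (N : ℕ → ℕ) (hN : IsIdRange N) :
    disjointnessOnEdge ∈ Decided N [Round.LOCAL] \ TwoRound N ∧
    (∀ ε : ℝ, 0 < ε → disjointnessOnEdge ∉ RandTwoRound N (1 / 2 - ε)) ∧
    pathDisjointness ∉ TwoRound N ∧
    (∀ ε : ℝ, 0 < ε → pathDisjointness ∉ RandTwoRound N (1 / 2 - ε)) :=
  ⟨⟨disjointnessOnEdge_mem_decided_local N,
      containsDisjointness_disjointnessOnEdge.not_mem_twoRound hN⟩,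
    fun _ hε => containsDisjointness_disjointnessOnEdge.not_mem_randTwoRound hN hε,
    containsDisjointness_pathDisjointness.not_mem_twoRound hN,
    fun _ hε => containsDisjointness_pathDisjointness.not_mem_randTwoRound hN hε⟩
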